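/- Let $A,B,K\in\mathbb{R}^{2\times 2}$ with $B$ invertible, put $\tilde A=A-BK$, let $\mathbf{x}_c\in\mathbb{R}^2$, $r>0$, $h(\mathbf{x})=\|\mathbf{x}-\mathbf{x}_c\|^2-r^2$ and $G(\mathbf{x})=B^\top B$. Let $\alpha:\mathbb{R}\to\mathbb{R}$ be of extended class $\mathcal{K}_\infty$ (strictly increasing, $\alpha(0)=0$, $\alpha(s)\to\pm\infty$ as $s\to\pm\infty$), differentiable at $0$ with $\alpha'(0)>0$. Consider the filtered system $$\dot{\mathbf{x}}=F(\mathbf{x}):=\tilde A\mathbf{x}+Bv(\mathbf{x}),\qquad v(\mathbf{x})=\begin{cases}0,&\eta(\mathbf{x})\ge 0,\\ -\dfrac{\eta(\mathbf{x})\,G(\mathbf{x})^{-1}B^\top\nabla h(\mathbf{x})}{(B^\top\nabla h(\mathbf{x}))^\top G(\mathbf{x})^{-1}B^\top\nabla h(\mathbf{x})},&\eta(\mathbf{x})<0,\end{cases}$$ where $\eta(\mathbf{x})=\nabla h(\mathbf{x})^\top\tilde A\mathbf{x}+\alpha(h(\mathbf{x}))$. A point $\mathbf{x}_*$ is an undesired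 equilibrium with indicator $\delta$ if $\delta<0$, $h(\mathbf{x}_*)=0$ and $\tilde A\mathbf{x}_*=\delta\, B\,G(\mathbf{x}_*)^{-1}B^\top\nabla h(\mathbf{x}_*)$. A saddle point of $F$ is an equilibrium at which $F$ is differentiable and the Jacobian of $F$ has no eigenvalue with zero real part, at least one eigenvalue with positive real part and at least one with negative real part. An equilibrium is asymptotically stable if it is Lyapunov stable and there is a neighbourhood of it such that from each of its points there is a solution defined for all $t\ge 0$, and all such solutions converge to the equilibrium. Suppose that $h(\mathbf{0})>0$, that $\tilde A$ is Hurwitz with two real eigenvalues $\lambda_1<\lambda_2$, and that $\mathbf{x}_c$ is not an eigenvector of $\tilde A$. Then there is no undesired equilibrium with indicator $\delta\in\{\frac{\lambda_1}{2},\frac{\lambda_2}{2}\}$. Moreover, if $\tilde A\mathbf{v}_1=\lambda_1\mathbf{v}_1$, $\tilde A\mathbf{v}_2=\lambda_2\mathbf{v}_2$, $\|\mathbf{v}_1\|=\|\mathbf{v}_2\|=1$, $\mathbf{v}_1^\top\mathbf{v}_2\ge 0$ and $\mathbf{x}_c=\beta_1\mathbf{v}_1+\beta_2\mathbf{v}_2$,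 the following holds. (i) If $\beta_1^2+\beta_1\beta_2\mathbf{v}_1^\top\mathbf{v}_2\ge 0$, then every undesired equilibrium with indicator $\delta<\frac{\lambda_1}{2}$ is a saddle point. (ii) If $\beta_1\beta_2\mathbf{v}_2^\top\mathbf{v}_1+\beta_2^2\ge 0$, then every undesired equilibrium with indicator $\frac{\lambda_2}{2}<\delta<0$ is asymptotically stable. (iii) Let $$F_1(\delta)=-|\lambda_1-2\delta|^2|\lambda_2-2\delta|^2r^2+|\lambda_1\beta_1|^2|\lambda_2-2\delta|^2+|\lambda_2\beta_2|^2|\lambda_1-2\delta|^2+2\lambda_1\beta_1\lambda_2\beta_2(\lambda_2-2\delta)(\lambda_1-2\delta)\mathbf{v}_1^\top\mathbf{v}_2.$$ If the cubic polynomial $\frac{dF_1}{d\delta}$ has exactly one real root and $\beta_1^2+\beta_1\beta_2\mathbf{v}_1^\top\mathbf{v}_2\ge 0$, then there is exactly one undesired equilibrium, and it is a saddle point. -/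

import Mathlib

namespace SafetyFilter

/-- The state space `ℝⁿ` with the Euclidean norm. -/
abbrev Vec (n : ℕ) : Type := EuclideanSpace ℝ (Fin n)

/-! ### Class K functions and spectra -/

/-- Functions of extended class `K∞`. -/
structure IsExtendedClassKInf (α : ℝ → ℝ) : Prop where
  map_zero : α 0 = 0
  strictMono : StrictMono α
  tendsto_atTop : Filter.Tendsto α Filter.atTop Filter.atTop
  tendsto_atBot : Filter.Tendsto α Filter.atBot Filter.atBot

/-- The set of complex eigenvalues of a real square matrix. -/
def complexEigenvalues {n : ℕ} (M : Matrix (Fin n) (Fin n) ℝ) : Set ℂ :=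
  spectrum ℂ (M.map (algebraMap ℝ ℂ))

/-- A real matrix is Hurwitz if all its eigenvalues have negative real part. -/
def IsHurwitz {n : ℕ} (M : Matrix (Fin n) (Fin n) ℝ) : Prop :=
  ∀ μ ∈ complexEigenvalues M, μ.re < 0

/-- `x` is an eigenvector of the real matrix `M`. -/
def IsEigenvector {n : ℕ} (M : Matrix (Fin n) (Fin n) ℝ) (x : Vec n) : Prop :=
  x ≠ 0 ∧ ∃ μ : ℝ, M.toEuclideanLin x = μ • x

/-! ### Equilibria of vector fields and their stability -/

/-- The Jacobian matrix of `F` at `x`. -/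
noncomputable def jacobian {n : ℕ} (F : Vec n → Vec n) (x : Vec n) :
    Matrix (Fin n) (Fin n) ℝ :=
  Matrix.of fun i j => (fderiv ℝ F x (EuclideanSpace.single j 1)) i

/-- `x` is a saddle point of `F`: a hyperbolic equilibrium (no eigenvalue of the Jacobian lies on
the imaginary axis) whose Jacobian has an eigenvalue with positive real part and one with
negative real part. -/
structure IsSaddlePoint {n : ℕ} (F : Vec n → Vec n) (x : Vec n) : Prop where
  equilibrium : F x = 0
  differentiableAt : DifferentiableAt ℝ F x
  hyperbolic : ∀ μ ∈ complexEigenvalues (jacobian F x), μ.re ≠ 0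
  exists_pos : ∃ μ ∈ complexEigenvalues (jacobian F x), 0 < μ.re
  exists_neg : ∃ μ ∈ complexEigenvalues (jacobian F x), μ.re < 0

/-- `x` is an asymptotically stable equilibrium of `γ' = F γ`: it is Lyapunov stable and locally
attractive. From all initial conditions near `x` there are solutions for all
nonnegative times. -/
structure IsAsymptoticallyStable {n : ℕ} (F : Vec n → Vec n) (x : Vec n) : Prop where
  equilibrium : F x = 0
  stable : ∀ ε > 0, ∃ ρ > 0, ∀ (T : ℝ) (γ : ℝ → Vec n),
    IsIntegralCurveOn γ (fun _ => F) (Set.Ico 0 T) → dist (γ 0) x < ρ →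
      ∀ t ∈ Set.Ico 0 T, dist (γ t) x < ε
  attractive : ∃ ρ > 0, ∀ x₀ : Vec n, dist x₀ x < ρ →
    (∃ γ : ℝ → Vec n, γ 0 = x₀ ∧ IsIntegralCurveOn γ (fun _ => F) (Set.Ici 0)) ∧
    ∀ γ : ℝ → Vec n, γ 0 = x₀ → IsIntegralCurveOn γ (fun _ => F) (Set.Ici 0) →
      Filter.Tendsto γ Filter.atTop (nhds x)

/-! ### Linear systems with a safety filter -/

/-- The matrix `A - B K` of the nominal closed loop `x' = A x + B u`, `u = -K x`. -/
def nominalMatrix {n m : ℕ} (A : Matrix (Fin n) (Fin n) ℝ) (B : Matrix (Fin n) (Fin m) ℝ)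
    (K : Matrix (Fin m) (Fin n) ℝ) : Matrix (Fin n) (Fin n) ℝ :=
  A - B * K

/-- `η(x) = ∇h(x)ᵀ (A - B K) x + α(h(x))`. -/
noncomputable def eta {n m : ℕ} (A : Matrix (Fin n) (Fin n) ℝ) (B : Matrix (Fin n) (Fin m) ℝ)
    (K : Matrix (Fin m) (Fin n) ℝ) (h : Vec n → ℝ) (α : ℝ → ℝ) (x : Vec n) : ℝ :=
  inner ℝ (gradient h x) ((nominalMatrix A B K).toEuclideanLin x) + α (h x)

/-- The vector `Bᵀ ∇h(x)`. -/
noncomputable def inputGradient {n m : ℕ} (B : Matrix (Fin n) (Fin m) ℝ) (h : Vec n → ℝ)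
    (x : Vec n) : Vec m :=
  B.transpose.toEuclideanLin (gradient h x)

/-- The vector `G(x)⁻¹ Bᵀ ∇h(x)`. -/
noncomputable def filterDirection {n m : ℕ} (B : Matrix (Fin n) (Fin m) ℝ)
    (G : Vec n → Matrix (Fin m) (Fin m) ℝ) (h : Vec n → ℝ) (x : Vec n) : Vec m :=
  ((G x)⁻¹).toEuclideanLin (inputGradient B h x)

open Classical in
/-- The safety filter: `v(x) = 0` if `η(x) ≥ 0`, and
`v(x) = - η(x) G(x)⁻¹ Bᵀ ∇h(x) / ‖Bᵀ ∇h(x)‖²` otherwise, the norm being the one weighted by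
`G(x)⁻¹`, that is, `‖w‖² = wᵀ G(x)⁻¹ w`. -/
noncomputable def safetyFilter {n m : ℕ} (A : Matrix (Fin n) (Fin n) ℝ)
    (B : Matrix (Fin n) (Fin m) ℝ) (K : Matrix (Fin m) (Fin n) ℝ)
    (G : Vec n → Matrix (Fin m) (Fin m) ℝ) (h : Vec n → ℝ) (α : ℝ → ℝ) (x : Vec n) : Vec m :=
  if 0 ≤ eta A B K h α x then 0
  else (-(eta A B K h α x / inner ℝ (inputGradient B h x) (filterDirection B G h x))) •
    filterDirection B G h x

/-- The filtered vector field `F(x) = (A - B K) x + B v(x)`. -/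
noncomputable def filteredField {n m : ℕ} (A : Matrix (Fin n) (Fin n) ℝ)
    (B : Matrix (Fin n) (Fin m) ℝ) (K : Matrix (Fin m) (Fin n) ℝ)
    (G : Vec n → Matrix (Fin m) (Fin m) ℝ) (h : Vec n → ℝ) (α : ℝ → ℝ) (x : Vec n) : Vec n :=
  (nominalMatrix A B K).toEuclideanLin x + B.toEuclideanLin (safetyFilter A B K G h α x)

/-- `(x, δ)` solves `h(x) = 0`, `(A - B K) x = δ B G(x)⁻¹ Bᵀ ∇h(x)`; that is, `δ` is an indicator
of the potential undesired equilibrium `x`. -/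
def HasIndicator {n m : ℕ} (A : Matrix (Fin n) (Fin n) ℝ)
    (B : Matrix (Fin n) (Fin m) ℝ) (K : Matrix (Fin m) (Fin n) ℝ)
    (G : Vec n → Matrix (Fin m) (Fin m) ℝ) (h : Vec n → ℝ) (x : Vec n) (δ : ℝ) : Prop :=
  h x = 0 ∧
    (nominalMatrix A B K).toEuclideanLin x = δ • B.toEuclideanLin (filterDirection B G h x)

/-- The set of undesired equilibria: those `x` with an indicator `δ < 0`. -/
def undesiredEquilibria {n m : ℕ} (A : Matrix (Fin n) (Fin n) ℝ)
    (B : Matrix (Fin n) (Fin m) ℝ) (K : Matrix (Fin m) (Fin n) ℝ)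
    (G : Vec n → Matrix (Fin m) (Fin m) ℝ) (h : Vec n → ℝ) : Set (Vec n) :=
  {x | ∃ δ < 0, HasIndicator A B K G h x δ}

/-- `h(x) = ‖x - x_c‖² - r²`: the unsafe set `h < 0` is the open disc with centre `x_c` and
radius `r`. -/
noncomputable def circularBarrier (xc : Vec 2) (r : ℝ) (x : Vec 2) : ℝ :=
  ‖x - xc‖ ^ 2 - r ^ 2

/-- The constant weight `G(x) = Bᵀ B`. -/
def gramWeight (B : Matrix (Fin 2) (Fin 2) ℝ) (_x : Vec 2) : Matrix (Fin 2) (Fin 2) ℝ :=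
  B.transpose * B

/-- The quartic polynomial `F₁(δ)`. -/
noncomputable def F₁ (r lam₁ lam₂ β₁ β₂ : ℝ) (v₁ v₂ : Vec 2) (δ : ℝ) : ℝ :=
  -(|lam₁ - 2 * δ| ^ 2 * |lam₂ - 2 * δ| ^ 2 * r ^ 2)
    + |lam₁ * β₁| ^ 2 * |lam₂ - 2 * δ| ^ 2
    + |lam₂ * β₂| ^ 2 * |lam₁ - 2 * δ| ^ 2
    + lam₁ * β₁ * lam₂ * β₂ * (lam₂ - 2 * δ) * (lam₁ - 2 * δ) * inner ℝ v₁ v₂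
    + lam₁ * β₁ * lam₂ * β₂ * (lam₂ - 2 * δ) * (lam₁ - 2 * δ) * inner ℝ v₂ v₁

end SafetyFilter

open SafetyFilter

namespace SafetyFilter

theorem mem_complexEigenvalues_fin_two (M : Matrix (Fin 2) (Fin 2) ℝ) (μ : ℂ) :
    μ ∈ complexEigenvalues M ↔ μ ^ 2 - (M.trace : ℂ) * μ + (M.det : ℂ) = 0 := by
  unfold complexEigenvalues
  rw [Matrix.mem_spectrum_iff_isRoot_charpoly, Polynomial.IsRoot.def, Matrix.charpoly_fin_two]
  simp [Matrix.trace_fin_two, Matrix.det_fin_two]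

theorem trace_and_det_of_complexEigenvalues {M : Matrix (Fin 2) (Fin 2) ℝ} {a b : ℝ} (hab : a ≠ b)
    (h : complexEigenvalues M = {(a : ℂ), (b : ℂ)}) : M.trace = a + b ∧ M.det = a * b := by
  have h1 := (mem_complexEigenvalues_fin_two M a).1 (by simp [h])
  have h2 := (mem_complexEigenvalues_fin_two M b).1 (by simp [h])
  norm_cast at h1 h2
  have h3 : M.trace = a + b := by
    have : (a - b) * (M.trace - (a + b)) = 0 := by linear_combination h2 - h1
    rcases mul_eq_zero.1 this with h | h
    · exact absurd (sub_eq_zero.1 h) hab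
    · linarith
  exact ⟨h3, by rw [h3] at h1; linear_combination h1⟩

theorem complexEigenvalues_eq_pair {M : Matrix (Fin 2) (Fin 2) ℝ} {a b : ℝ}
    (ht : M.trace = a + b) (hd : M.det = a * b) : complexEigenvalues M = {(a : ℂ), (b : ℂ)} := by
  ext μ
  rw [mem_complexEigenvalues_fin_two, ht, hd, Set.mem_insert_iff, Set.mem_singleton_iff,
    ← sub_eq_zero (b := (a : ℂ)), ← sub_eq_zero (b := (b : ℂ)), ← mul_eq_zero]
  push_cast
  constructor <;> intro h <;> linear_combination h

theorem cayley_hamilton_fin_two (M : Matrix (Fin 2) (Fin 2) ℝ) (u : Vec 2) :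
    M.toEuclideanLin (M.toEuclideanLin u) = M.trace • M.toEuclideanLin u - M.det • u := by
  ext i
  fin_cases i <;>
  simp [Matrix.toLpLin_apply, Matrix.trace_fin_two, Matrix.det_fin_two] <;> ring

theorem hasGradientAt_circularBarrier (xc : Vec 2) (r : ℝ) (x : Vec 2) :
    HasGradientAt (circularBarrier xc r) ((2 : ℝ) • (x - xc)) x := by
  have h := (((hasFDerivAt_id x).sub_const xc).norm_sq).sub_const (r ^ 2)
  rw [hasGradientAt_iff_hasFDerivAt]
  refine h.congr_fderiv ?_
  ext u
  simp

theorem gradient_circularBarrier (xc : Vec 2) (r : ℝ) (x : Vec 2) :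
    gradient (circularBarrier xc r) x = (2 : ℝ) • (x - xc) :=
  (hasGradientAt_circularBarrier xc r x).gradient

theorem gramWeight_inv_cancel {B : Matrix (Fin 2) (Fin 2) ℝ} (hB : IsUnit B) (x : Vec 2) :
    B * ((gramWeight B x)⁻¹ * B.transpose) = 1 := by
  have hd : IsUnit B.det := (Matrix.isUnit_iff_isUnit_det B).1 hB
  have hdt : IsUnit B.transpose.det := by rwa [Matrix.det_transpose]
  rw [gramWeight, Matrix.mul_inv_rev, Matrix.mul_assoc, Matrix.nonsing_inv_mul _ hdt,
    Matrix.mul_one, Matrix.mul_nonsing_inv _ hd]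

theorem toEuclideanLin_filterDirection {B : Matrix (Fin 2) (Fin 2) ℝ} (hB : IsUnit B)
    (h : Vec 2 → ℝ) (x : Vec 2) :
    B.toEuclideanLin (filterDirection B (gramWeight B) h x) = gradient h x := by
  have := gramWeight_inv_cancel hB x
  rw [filterDirection, inputGradient, Matrix.toLpLin_apply, Matrix.toLpLin_apply,
    Matrix.toLpLin_apply, Matrix.mulVec_mulVec, Matrix.mulVec_mulVec, Matrix.mul_assoc, this,
    Matrix.one_mulVec]

theorem inner_transpose_toEuclideanLin (B : Matrix (Fin 2) (Fin 2) ℝ) (u w : Vec 2) :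
    inner ℝ (B.transpose.toEuclideanLin u) w = inner ℝ u (B.toEuclideanLin w) := by
  simp [Matrix.toLpLin_apply, dotProduct, Fin.sum_univ_two,
    EuclideanSpace.inner_eq_star_dotProduct]
  ring

theorem inner_inputGradient_filterDirection {B : Matrix (Fin 2) (Fin 2) ℝ} (hB : IsUnit B)
    (h : Vec 2 → ℝ) (x : Vec 2) :
    inner ℝ (inputGradient B h x) (filterDirection B (gramWeight B) h x) = ‖gradient h x‖ ^ 2 := by
  rw [inputGradient, inner_transpose_toEuclideanLin, toEuclideanLin_filterDirection hB,
    real_inner_self_eq_norm_sq]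

theorem hasIndicator_iff {A B K : Matrix (Fin 2) (Fin 2) ℝ} (hB : IsUnit B) {xc : Vec 2} {r : ℝ}
    {x : Vec 2} {δ : ℝ} :
    HasIndicator A B K (gramWeight B) (circularBarrier xc r) x δ ↔
      ‖x - xc‖ ^ 2 = r ^ 2 ∧
        (nominalMatrix A B K).toEuclideanLin x = (2 * δ) • (x - xc) := by
  rw [HasIndicator, toEuclideanLin_filterDirection hB, gradient_circularBarrier, smul_smul,
    mul_comm δ 2, circularBarrier, sub_eq_zero]

theorem eta_circularBarrier (A B K : Matrix (Fin 2) (Fin 2) ℝ) (xc : Vec 2) (r : ℝ) (α : ℝ → ℝ)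
    (x : Vec 2) :
    eta A B K (circularBarrier xc r) α x =
      2 * inner ℝ (x - xc) ((nominalMatrix A B K).toEuclideanLin x) +
        α (‖x - xc‖ ^ 2 - r ^ 2) := by
  rw [eta, gradient_circularBarrier, inner_smul_left, circularBarrier]
  rfl

theorem filteredField_of_eta_neg {A B K : Matrix (Fin 2) (Fin 2) ℝ} (hB : IsUnit B) {xc : Vec 2}
    {r : ℝ} {α : ℝ → ℝ} {x : Vec 2} (hx : eta A B K (circularBarrier xc r) α x < 0) :
    filteredField A B K (gramWeight B) (circularBarrier xc r) α x =
      (nominalMatrix A B K).toEuclideanLin x -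
        (eta A B K (circularBarrier xc r) α x / (2 * ‖x - xc‖ ^ 2)) • (x - xc) := by
  rw [filteredField, safetyFilter, if_neg (not_le.2 hx), map_smul,
    toEuclideanLin_filterDirection hB, inner_inputGradient_filterDirection hB,
    gradient_circularBarrier, smul_smul, sub_eq_add_neg _ (_ • _), ← neg_smul, norm_smul]
  congr 2
  norm_num
  rw [mul_pow, div_mul_eq_mul_div]
  ring

theorem inner_fin_two (u w : Vec 2) : inner ℝ u w = u 0 * w 0 + u 1 * w 1 := by
  simp [EuclideanSpace.inner_eq_star_dotProduct, dotProduct, Fin.sum_univ_two]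
  ring

theorem hasFDerivAt_eta {A B K : Matrix (Fin 2) (Fin 2) ℝ} {xc : Vec 2}
    {r : ℝ} {α : ℝ → ℝ} (hα : DifferentiableAt ℝ α 0) {x : Vec 2} {δ : ℝ}
    (hr : ‖x - xc‖ ^ 2 = r ^ 2)
    (hx : (nominalMatrix A B K).toEuclideanLin x = (2 * δ) • (x - xc)) :
    ∃ L : Vec 2 →L[ℝ] ℝ, HasFDerivAt (eta A B K (circularBarrier xc r) α) L x ∧
      ∀ u, L u = 2 * ((2 * δ + deriv α 0) * inner ℝ (x - xc) u +
        inner ℝ (x - xc) ((nominalMatrix A B K).toEuclideanLin u)) := by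
  set T := LinearMap.toContinuousLinearMap (nominalMatrix A B K).toEuclideanLin with hT
  have h1 : HasFDerivAt (fun z : Vec 2 => z - xc) (ContinuousLinearMap.id ℝ (Vec 2)) x :=
    (hasFDerivAt_id x).sub_const xc
  have h2 := (h1.inner ℝ (T.hasFDerivAt (x := x))).const_mul 2
  have h0 : HasDerivAt α (deriv α 0) (‖x - xc‖ ^ 2 - r ^ 2) := by
    rw [hr, sub_self]; exact hα.hasDerivAt
  have h3 := h0.comp_hasFDerivAt x (h1.norm_sq.sub_const (r ^ 2))
  have h4 := h2.add h3
  refine ⟨_, h4.congr_of_eventuallyEq (Filter.Eventually.of_forall fun z => ?_), fun u => ?_⟩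
  · rw [eta_circularBarrier]; rfl
  · have h5 : T x = (2 * δ) • (x - xc) := hx
    simp only [add_apply, smul_apply, ContinuousLinearMap.comp_apply,
      fderivInnerCLM_apply, ContinuousLinearMap.prod_apply, h5, innerSL_apply_apply,
      ContinuousLinearMap.id_apply, inner_smul_right, real_inner_comm (x - xc) u,
      smul_eq_mul, nsmul_eq_mul]
    rw [hT, LinearMap.coe_toContinuousLinearMap']
    push_cast
    ring

theorem hasFDerivAt_filteredField {A B K : Matrix (Fin 2) (Fin 2) ℝ} (hB : IsUnit B) {xc : Vec 2}
    {r : ℝ} (hr0 : 0 < r) {α : ℝ → ℝ} (hα0 : α 0 = 0) (hα : DifferentiableAt ℝ α 0) {x : Vec 2}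
    {δ : ℝ} (hδ : δ < 0) (hr : ‖x - xc‖ ^ 2 = r ^ 2)
    (hx : (nominalMatrix A B K).toEuclideanLin x = (2 * δ) • (x - xc)) :
    filteredField A B K (gramWeight B) (circularBarrier xc r) α x = 0 ∧
    ∃ L : Vec 2 →L[ℝ] Vec 2,
      HasFDerivAt (filteredField A B K (gramWeight B) (circularBarrier xc r) α) L x ∧
      ∀ u, L u = (nominalMatrix A B K).toEuclideanLin u - (2 * δ) • u +
        (((2 * δ - deriv α 0) * inner ℝ (x - xc) u -
          inner ℝ (x - xc) ((nominalMatrix A B K).toEuclideanLin u)) / r ^ 2) • (x - xc) := by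
  have hr2 : 0 < r ^ 2 := by positivity
  have hη : eta A B K (circularBarrier xc r) α x = 4 * δ * r ^ 2 := by
    rw [eta_circularBarrier, hx, inner_smul_right, real_inner_self_eq_norm_sq, hr, sub_self, hα0]
    ring
  have hneg : eta A B K (circularBarrier xc r) α x < 0 := by rw [hη]; nlinarith
  refine ⟨?_, ?_⟩
  · rw [filteredField_of_eta_neg hB hneg, hη, hx, hr, ← sub_smul]
    convert zero_smul ℝ _
    field_simp
    ring
  obtain ⟨E, hE, hEu⟩ := hasFDerivAt_eta (A := A) (B := B) (K := K) hα hr hx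
  set T := LinearMap.toContinuousLinearMap (nominalMatrix A B K).toEuclideanLin with hT
  have h1 : HasFDerivAt (fun z : Vec 2 => z - xc) (ContinuousLinearMap.id ℝ (Vec 2)) x :=
    (hasFDerivAt_id x).sub_const xc
  have hinv : HasDerivAt (fun t : ℝ => (2 * t)⁻¹) (-2 / (2 * ‖x - xc‖ ^ 2) ^ 2) (‖x - xc‖ ^ 2) := by
    have := ((hasDerivAt_id (‖x - xc‖ ^ 2)).const_mul 2).inv (by rw [hr]; simp; positivity)
    rw [mul_one] at this
    exact this
  have h2 := hE.mul (hinv.comp_hasFDerivAt x h1.norm_sq)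
  have h3 := (T.hasFDerivAt (x := x)).sub (h2.smul h1)
  refine ⟨_, h3.congr_of_eventuallyEq ?_, fun u => ?_⟩
  · filter_upwards [hE.continuousAt.eventually_lt continuousAt_const hneg] with z hz
    rw [filteredField_of_eta_neg hB hz]
    simp [hT, div_eq_mul_inv]
  · simp only [sub_apply, add_apply,
      smul_apply, ContinuousLinearMap.smulRight_apply, hEu, hη, hr,
      Pi.mul_apply, Function.comp_apply, ContinuousLinearMap.comp_apply, innerSL_apply_apply,
      ContinuousLinearMap.id_apply, hT, LinearMap.coe_toContinuousLinearMap', smul_eq_mul]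
    rw [show 4 * δ * r ^ 2 * (2 * r ^ 2)⁻¹ = 2 * δ by field_simp; ring, nsmul_eq_mul]
    push_cast
    match_scalars <;> field_simp <;> ring

theorem trace_and_det_projected {M J : Matrix (Fin 2) (Fin 2) ℝ} {y : Vec 2} {r c a κ : ℝ}
    (hr0 : 0 < r) (hr : ‖y‖ ^ 2 = r ^ 2)
    (hκ : κ = M.trace - c - inner ℝ y (M.toEuclideanLin y) / r ^ 2)
    (hJ : ∀ i j, J i j = (M.toEuclideanLin (EuclideanSpace.single j 1) -
      c • EuclideanSpace.single j 1 +
        (((c - a) * inner ℝ y (EuclideanSpace.single j 1) -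
          inner ℝ y (M.toEuclideanLin (EuclideanSpace.single j 1))) / r ^ 2) • y : Vec 2) i) :
    J.trace = κ + (-a) ∧ J.det = κ * (-a) := by
  have hr2 : r ^ 2 = y 0 ^ 2 + y 1 ^ 2 := by
    rw [← hr, ← real_inner_self_eq_norm_sq, inner_fin_two]; ring
  have hne : y 0 ^ 2 + y 1 ^ 2 ≠ 0 := by rw [← hr2]; positivity
  subst hκ
  simp only [Matrix.trace_fin_two, Matrix.det_fin_two, hJ, hr2, inner_fin_two]
  simp [Matrix.toLpLin_apply]
  constructor <;> field_simp <;> ring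

theorem isSaddlePoint_of_pos {A B K : Matrix (Fin 2) (Fin 2) ℝ} (hB : IsUnit B) {xc : Vec 2}
    {r : ℝ} (hr0 : 0 < r) {α : ℝ → ℝ} (hα0 : α 0 = 0) (hα : DifferentiableAt ℝ α 0)
    (hαpos : 0 < deriv α 0) {x : Vec 2}
    {δ : ℝ} (hδ : δ < 0) (hr : ‖x - xc‖ ^ 2 = r ^ 2)
    (hx : (nominalMatrix A B K).toEuclideanLin x = (2 * δ) • (x - xc))
    (hκ : 0 < (nominalMatrix A B K).trace - 2 * δ -
      inner ℝ (x - xc) ((nominalMatrix A B K).toEuclideanLin (x - xc)) / r ^ 2) :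
    IsSaddlePoint (filteredField A B K (gramWeight B) (circularBarrier xc r) α) x := by
  obtain ⟨h0, L, hL, hLu⟩ := hasFDerivAt_filteredField hB hr0 hα0 hα hδ hr hx
  obtain ⟨ht, hd⟩ := trace_and_det_projected
    (J := jacobian (filteredField A B K (gramWeight B) (circularBarrier xc r) α) x)
    (a := deriv α 0) hr0 hr rfl
    (fun i j => by rw [jacobian, Matrix.of_apply, hL.fderiv, hLu])
  have hs := complexEigenvalues_eq_pair ht hd
  rw [Set.ext_iff] at hs
  refine ⟨h0, hL.differentiableAt, fun μ hμ => ?_, ⟨_, (hs _).2 (Or.inl rfl), ?_⟩,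
    ⟨_, (hs _).2 (Or.inr rfl), ?_⟩⟩
  · rcases (hs _).1 hμ with rfl | rfl
    · rw [Complex.ofReal_re]; exact hκ.ne'
    · rw [Complex.ofReal_re]; exact (neg_neg_of_pos hαpos).ne
  · rw [Complex.ofReal_re]; exact hκ
  · rw [Complex.ofReal_re]; exact neg_neg_of_pos hαpos

theorem norm_combination_sq {v₁ v₂ : Vec 2} (h₁ : ‖v₁‖ = 1) (h₂ : ‖v₂‖ = 1) (a b : ℝ) :
    ‖a • v₁ + b • v₂‖ ^ 2 = a ^ 2 + b ^ 2 + 2 * (a * b * inner ℝ v₁ v₂) := by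
  rw [norm_add_sq_real, norm_smul, norm_smul, h₁, h₂, inner_smul_left, inner_smul_right]
  simp
  ring

theorem inner_combination {v₁ v₂ : Vec 2} (h₁ : ‖v₁‖ = 1) (h₂ : ‖v₂‖ = 1) (a b c d : ℝ) :
    inner ℝ (a • v₁ + b • v₂) (c • v₁ + d • v₂) =
      a * c + b * d + (a * d + b * c) * inner ℝ v₁ v₂ := by
  simp only [inner_add_left, inner_add_right, real_inner_smul_left, real_inner_smul_right,
    real_inner_self_eq_norm_sq, h₁, h₂, real_inner_comm v₁ v₂]
  ring

theorem injective_sub_smul {M : Matrix (Fin 2) (Fin 2) ℝ} {l₁ l₂ c : ℝ}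
    (ht : M.trace = l₁ + l₂) (hd : M.det = l₁ * l₂) (h₁ : l₁ - c ≠ 0) (h₂ : l₂ - c ≠ 0)
    {u w : Vec 2} (h : M.toEuclideanLin u - c • u = M.toEuclideanLin w - c • w) : u = w := by
  have hz : M.toEuclideanLin (u - w) = c • (u - w) := by
    rw [map_sub, smul_sub, sub_eq_sub_iff_sub_eq_sub.1 h]
  have hc := cayley_hamilton_fin_two M (u - w)
  rw [hz, map_smul, hz, ht, hd] at hc
  have : ((l₁ - c) * (l₂ - c)) • (u - w) = 0 := by
    rw [← sub_eq_zero] at hc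
    rw [← hc]
    module
  rcases smul_eq_zero.1 this with h | h
  · exact absurd h (mul_ne_zero h₁ h₂)
  · exact sub_eq_zero.1 h

theorem isEigenvector_of_resonance {M : Matrix (Fin 2) (Fin 2) ℝ} {l₁ l₂ : ℝ}
    (ht : M.trace = l₁ + l₂) (hd : M.det = l₁ * l₂) (h₁ : l₁ ≠ 0) {x xc : Vec 2} (hxc : xc ≠ 0)
    (hx : M.toEuclideanLin x = l₁ • (x - xc)) : IsEigenvector M xc := by
  refine ⟨hxc, l₂, ?_⟩
  have hc := cayley_hamilton_fin_two M x
  rw [hx, map_smul, map_sub, hx, ht, hd] at hc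
  have : l₁ • (M.toEuclideanLin xc - l₂ • xc) = 0 := by
    rw [← sub_eq_zero, ← neg_eq_zero] at hc
    rw [← hc]
    module
  exact sub_eq_zero.1 ((smul_eq_zero.1 this).resolve_left h₁)

theorem combination_equilibrium {M : Matrix (Fin 2) (Fin 2) ℝ} {l₁ l₂ c : ℝ} {v₁ v₂ : Vec 2}
    (hv₁ : M.toEuclideanLin v₁ = l₁ • v₁) (hv₂ : M.toEuclideanLin v₂ = l₂ • v₂) {β₁ β₂ : ℝ}
    (h₁ : l₁ - c ≠ 0) (h₂ : l₂ - c ≠ 0) {y : Vec 2}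
    (hy : y = -((l₁ * β₁ / (l₁ - c)) • v₁ + (l₂ * β₂ / (l₂ - c)) • v₂)) :
    M.toEuclideanLin (y + (β₁ • v₁ + β₂ • v₂)) = c • y := by
  subst hy
  simp only [map_add, map_neg, map_smul, hv₁, hv₂]
  match_scalars <;> field_simp <;> ring

theorem equilibrium_iff {M : Matrix (Fin 2) (Fin 2) ℝ} {l₁ l₂ c : ℝ}
    (ht : M.trace = l₁ + l₂) (hd : M.det = l₁ * l₂) {v₁ v₂ : Vec 2}
    (hv₁ : M.toEuclideanLin v₁ = l₁ • v₁) (hv₂ : M.toEuclideanLin v₂ = l₂ • v₂) {β₁ β₂ : ℝ}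
    {xc : Vec 2} (hxc : xc = β₁ • v₁ + β₂ • v₂)
    (h₁ : l₁ - c ≠ 0) (h₂ : l₂ - c ≠ 0) {x : Vec 2} :
    M.toEuclideanLin x = c • (x - xc) ↔
      x - xc = -((l₁ * β₁ / (l₁ - c)) • v₁ + (l₂ * β₂ / (l₂ - c)) • v₂) := by
  constructor
  · intro h
    have h' := combination_equilibrium hv₁ hv₂ (β₁ := β₁) (β₂ := β₂) h₁ h₂ rfl
    rw [← hxc] at h'
    apply injective_sub_smul ht hd h₁ h₂
    rw [map_add, ← eq_sub_iff_add_eq] at h'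
    rw [h', map_sub, h]
    module
  · intro h
    have := combination_equilibrium hv₁ hv₂ (β₁ := β₁) (β₂ := β₂) h₁ h₂ h
    rwa [← hxc, sub_add_cancel] at this

theorem coefficients_ne_zero {M : Matrix (Fin 2) (Fin 2) ℝ} {l₁ l₂ : ℝ} {v₁ v₂ : Vec 2}
    (hv₁ : M.toEuclideanLin v₁ = l₁ • v₁) (hv₂ : M.toEuclideanLin v₂ = l₂ • v₂) {β₁ β₂ : ℝ}
    {xc : Vec 2} (hxc : xc = β₁ • v₁ + β₂ • v₂) (h0 : xc ≠ 0) (he : ¬ IsEigenvector M xc) :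
    β₁ ≠ 0 ∧ β₂ ≠ 0 := by
  constructor <;> rintro rfl <;> refine he ⟨h0, ?_⟩
  · exact ⟨l₂, by rw [hxc, zero_smul, zero_add, map_smul, hv₂, smul_comm]⟩
  · exact ⟨l₁, by rw [hxc, zero_smul, add_zero, map_smul, hv₁, smul_comm]⟩

/-- Positivity of the transversal rate at a boundary equilibrium beyond the first eigenvalue. -/
theorem transversal_form_pos {l₁ l₂ c β₁ β₂ g : ℝ} (hl : l₁ < l₂) (h₂ : l₂ < 0) (hc : c < l₁)
    (hβ : 0 ≤ β₁ ^ 2 + β₁ * β₂ * g)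
    (hpos : 0 < (l₁ * β₁ / (l₁ - c)) ^ 2 + (l₂ * β₂ / (l₂ - c)) ^ 2 +
      2 * ((l₁ * β₁ / (l₁ - c)) * (l₂ * β₂ / (l₂ - c)) * g)) :
    0 < (l₂ - c) * (l₁ * β₁ / (l₁ - c)) ^ 2 + (l₁ - c) * (l₂ * β₂ / (l₂ - c)) ^ 2 +
      (l₁ - c + (l₂ - c)) * ((l₁ * β₁ / (l₁ - c)) * (l₂ * β₂ / (l₂ - c)) * g) := by
  have hp₁ : 0 < l₁ - c := by linarith
  have hp₂ : 0 < l₂ - c := by linarith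
  obtain ⟨a, ha⟩ : ∃ a, a = -l₁ / (l₁ - c) := ⟨_, rfl⟩
  obtain ⟨b, hb⟩ : ∃ b, b = -l₂ / (l₂ - c) := ⟨_, rfl⟩
  have hb0 : 0 < b := by rw [hb]; exact div_pos (by linarith) hp₂
  have hab : b ≤ a := by
    rw [ha, hb, div_le_div_iff₀ hp₂ hp₁]
    nlinarith
  rw [show l₁ * β₁ / (l₁ - c) = -(a * β₁) by rw [ha]; ring,
    show l₂ * β₂ / (l₂ - c) = -(b * β₂) by rw [hb]; ring] at hpos ⊢
  have key : 0 ≤ (a * β₁) ^ 2 + (a * β₁) * (b * β₂) * g := by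
    have h1 := mul_nonneg (mul_nonneg (hb0.le.trans hab) hb0.le) hβ
    have h2 := mul_nonneg (mul_nonneg (hb0.le.trans hab) (sub_nonneg.2 hab)) (sq_nonneg β₁)
    nlinarith
  nlinarith [mul_nonneg (sub_nonneg.2 hl.le) key, mul_pos hp₁ hpos]

theorem sq_le_sq_of_slow_indicator {l₁ l₂ c β₁ β₂ g : ℝ} (hl : l₁ < l₂) (hc : l₂ < c)
    (hc0 : c < 0) (hβ : 0 ≤ β₁ * β₂ * g + β₂ ^ 2) (hpos : 0 ≤ β₁ ^ 2 + β₂ ^ 2 + 2 * (β₁ * β₂ * g)) :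
    β₁ ^ 2 + β₂ ^ 2 + 2 * (β₁ * β₂ * g) ≤
      (l₁ * β₁ / (l₁ - c)) ^ 2 + (l₂ * β₂ / (l₂ - c)) ^ 2 +
        2 * ((l₁ * β₁ / (l₁ - c)) * (l₂ * β₂ / (l₂ - c)) * g) := by
  have hp₁ : l₁ - c < 0 := by linarith
  have hp₂ : l₂ - c < 0 := by linarith
  obtain ⟨a, ha⟩ : ∃ a, a = l₁ / (l₁ - c) := ⟨_, rfl⟩
  obtain ⟨b, hb⟩ : ∃ b, b = l₂ / (l₂ - c) := ⟨_, rfl⟩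
  have ha1 : 1 ≤ a := by rw [ha, one_le_div_of_neg hp₁]; linarith
  have hab : a ≤ b := by
    rw [ha, hb, ← neg_div_neg_eq, ← neg_div_neg_eq l₂, div_le_div_iff₀ (by linarith) (by linarith)]
    nlinarith
  rw [show l₁ * β₁ / (l₁ - c) = a * β₁ by rw [ha]; ring,
    show l₂ * β₂ / (l₂ - c) = b * β₂ by rw [hb]; ring]
  have h1 := mul_nonneg (mul_nonneg (zero_le_one.trans ha1) (sub_nonneg.2 hab)) hβ
  have h2 := mul_nonneg (sq_nonneg (b - a)) (sq_nonneg β₂)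
  have h3 := mul_nonneg (show 0 ≤ a ^ 2 - 1 by nlinarith) hpos
  nlinarith

open Filter Topology

theorem F₁_eq (r l₁ l₂ β₁ β₂ : ℝ) (v₁ v₂ : Vec 2) (δ : ℝ) :
    F₁ r l₁ l₂ β₁ β₂ v₁ v₂ δ = -((l₁ - 2 * δ) ^ 2 * (l₂ - 2 * δ) ^ 2 * r ^ 2)
      + (l₁ * β₁) ^ 2 * (l₂ - 2 * δ) ^ 2 + (l₂ * β₂) ^ 2 * (l₁ - 2 * δ) ^ 2
      + 2 * (l₁ * β₁ * l₂ * β₂ * (l₂ - 2 * δ) * (l₁ - 2 * δ) * inner ℝ v₁ v₂) := by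
  rw [F₁, real_inner_comm v₁ v₂]
  simp only [sq_abs]
  ring

theorem differentiable_F₁ (r l₁ l₂ β₁ β₂ : ℝ) (v₁ v₂ : Vec 2) :
    Differentiable ℝ (F₁ r l₁ l₂ β₁ β₂ v₁ v₂) := by
  rw [funext (F₁_eq r l₁ l₂ β₁ β₂ v₁ v₂)]
  fun_prop

theorem F₁_eq_mul (r : ℝ) {l₁ l₂ : ℝ} (β₁ β₂ : ℝ) {v₁ v₂ : Vec 2} (hv₁ : ‖v₁‖ = 1)
    (hv₂ : ‖v₂‖ = 1) {δ : ℝ} (h₁ : l₁ - 2 * δ ≠ 0) (h₂ : l₂ - 2 * δ ≠ 0) :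
    F₁ r l₁ l₂ β₁ β₂ v₁ v₂ δ = ((l₁ - 2 * δ) * (l₂ - 2 * δ)) ^ 2 *
      (‖(l₁ * β₁ / (l₁ - 2 * δ)) • v₁ + (l₂ * β₂ / (l₂ - 2 * δ)) • v₂‖ ^ 2 - r ^ 2) := by
  rw [F₁_eq, norm_combination_sq hv₁ hv₂]
  field_simp
  ring

theorem eventually_F₁_neg {r : ℝ} (hr : 0 < r) {l₁ l₂ : ℝ} (β₁ β₂ : ℝ) {v₁ v₂ : Vec 2}
    (hv₁ : ‖v₁‖ = 1) (hv₂ : ‖v₂‖ = 1) {f : Filter ℝ}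
    (hf : ∀ l : ℝ, Tendsto (fun δ => (l - 2 * δ)⁻¹) f (𝓝 0))
    (hf' : ∀ l : ℝ, ∀ᶠ δ in f, l - 2 * δ ≠ 0) :
    ∀ᶠ δ in f, F₁ r l₁ l₂ β₁ β₂ v₁ v₂ δ < 0 := by
  have h1 := ((hf l₁).const_mul (l₁ * β₁)).smul_const v₁
  have h2 := ((hf l₂).const_mul (l₂ * β₂)).smul_const v₂
  have h := (h1.add h2).norm.pow 2
  simp only [mul_zero, zero_smul, add_zero, norm_zero, ne_eq, OfNat.ofNat_ne_zero,
    not_false_eq_true, zero_pow, ← div_eq_mul_inv] at h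
  filter_upwards [h.eventually_lt_const (show 0 < r ^ 2 by positivity), hf' l₁, hf' l₂]
    with δ hδ hδ₁ hδ₂
  rw [F₁_eq_mul r β₁ β₂ hv₁ hv₂ hδ₁ hδ₂]
  exact mul_neg_of_pos_of_neg (by positivity) (by linarith)

theorem eventually_atBot_F₁_neg {r : ℝ} (hr : 0 < r) (l₁ l₂ β₁ β₂ : ℝ) {v₁ v₂ : Vec 2}
    (hv₁ : ‖v₁‖ = 1) (hv₂ : ‖v₂‖ = 1) :
    ∀ᶠ δ in atBot, F₁ r l₁ l₂ β₁ β₂ v₁ v₂ δ < 0 := by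
  have h (l : ℝ) : Tendsto (fun δ => l - 2 * δ) atBot atTop := by
    simp only [sub_eq_add_neg, ← neg_mul]
    exact tendsto_atTop_add_const_left _ _
      (tendsto_id.const_mul_atBot_of_neg (by norm_num : (-2 : ℝ) < 0))
  exact eventually_F₁_neg hr β₁ β₂ hv₁ hv₂ (fun l => tendsto_inv_atTop_zero.comp (h l))
    fun l => (h l).eventually_ne_atTop 0

theorem eventually_atTop_F₁_neg {r : ℝ} (hr : 0 < r) (l₁ l₂ β₁ β₂ : ℝ) {v₁ v₂ : Vec 2}
    (hv₁ : ‖v₁‖ = 1) (hv₂ : ‖v₂‖ = 1) :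
    ∀ᶠ δ in atTop, F₁ r l₁ l₂ β₁ β₂ v₁ v₂ δ < 0 := by
  have h (l : ℝ) : Tendsto (fun δ => l - 2 * δ) atTop atBot := by
    simp only [sub_eq_add_neg, ← neg_mul]
    exact tendsto_atBot_add_const_left _ _
      (tendsto_id.const_mul_atTop_of_neg (by norm_num : (-2 : ℝ) < 0))
  exact eventually_F₁_neg hr β₁ β₂ hv₁ hv₂ (fun l => tendsto_inv_atBot_zero.comp (h l))
    fun l => (h l).eventually_ne_atBot 0

/-- A differentiable function with a single critical point, negative near `±∞` and positive at `s`
and `t`, has exactly one zero to the left of `t`, and this zero lies to the left of `s`. -/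
theorem exists_unique_zero_of_single_critical_point {f : ℝ → ℝ} (hf : Differentiable ℝ f)
    (hcrit : ∃! δ : ℝ, deriv f δ = 0) (hbot : ∀ᶠ δ in atBot, f δ < 0)
    (htop : ∀ᶠ δ in atTop, f δ < 0) {s t : ℝ} (hst : s ≤ t) (hs : 0 < f s) (ht : 0 < f t) :
    ∃ d < s, f d = 0 ∧ ∀ d' < t, f d' = 0 → d' = d := by
  obtain ⟨a, ha, has⟩ := (hbot.and (eventually_lt_atBot s)).exists
  obtain ⟨b, hb, hbt⟩ := (htop.and (eventually_gt_atTop t)).exists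
  obtain ⟨d, hd, hd0⟩ := intermediate_value_Ioo has.le hf.continuous.continuousOn ⟨ha, hs⟩
  obtain ⟨e, he, he0⟩ := intermediate_value_Ioo' hbt.le hf.continuous.continuousOn ⟨hb, ht⟩
  have no_two : ∀ p q, p < q → q < t → f p = 0 → f q = 0 → False := by
    intro p q hpq hqt hp hq
    obtain ⟨m, hm, hm0⟩ := exists_deriv_eq_zero hpq hf.continuous.continuousOn (hp.trans hq.symm)
    obtain ⟨n, hn, hn0⟩ := exists_deriv_eq_zero (hqt.trans he.1) hf.continuous.continuousOn
      (hq.trans he0.symm)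
    exact absurd (hcrit.unique hm0 hn0) (hm.2.trans hn.1).ne
  refine ⟨d, hd.2, hd0, fun d' hd' h0 => ?_⟩
  rcases lt_trichotomy d' d with h | h | h
  · exact (no_two d' d h (hd.2.trans_le hst) h0 hd0).elim
  · exact h
  · exact (no_two d d' h hd' hd0 h0).elim

theorem isSaddlePoint_of_lt {A B K : Matrix (Fin 2) (Fin 2) ℝ} (hB : IsUnit B) {xc : Vec 2}
    {r : ℝ} (hr0 : 0 < r) {α : ℝ → ℝ} (hα0 : α 0 = 0) (hα : DifferentiableAt ℝ α 0)
    (hαpos : 0 < deriv α 0) {l₁ l₂ : ℝ} (hl : l₁ < l₂) (hl₂ : l₂ < 0)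
    (ht : (nominalMatrix A B K).trace = l₁ + l₂) (hd : (nominalMatrix A B K).det = l₁ * l₂)
    {v₁ v₂ : Vec 2} {β₁ β₂ : ℝ}
    (hv₁ : (nominalMatrix A B K).toEuclideanLin v₁ = l₁ • v₁)
    (hv₂ : (nominalMatrix A B K).toEuclideanLin v₂ = l₂ • v₂) (hn₁ : ‖v₁‖ = 1) (hn₂ : ‖v₂‖ = 1)
    (hxc : xc = β₁ • v₁ + β₂ • v₂) (hβ : 0 ≤ β₁ ^ 2 + β₁ * β₂ * inner ℝ v₁ v₂) {x : Vec 2} {δ : ℝ}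
    (hx : HasIndicator A B K (gramWeight B) (circularBarrier xc r) x δ) (hδ : δ < l₁ / 2) :
    IsSaddlePoint (filteredField A B K (gramWeight B) (circularBarrier xc r) α) x := by
  obtain ⟨hr, hx⟩ := (hasIndicator_iff hB).1 hx
  have hp₁ : l₁ - 2 * δ ≠ 0 := by linarith
  have hp₂ : l₂ - 2 * δ ≠ 0 := by linarith
  have hr2 : 0 < r ^ 2 := by positivity
  refine isSaddlePoint_of_pos hB hr0 hα0 hα hαpos (by linarith) hr hx ?_
  have hy := (equilibrium_iff ht hd hv₁ hv₂ hxc hp₁ hp₂).1 hx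
  rw [hy, norm_neg, norm_combination_sq hn₁ hn₂] at hr
  have key := transversal_form_pos hl hl₂ (show 2 * δ < l₁ by linarith) hβ (hr ▸ hr2)
  rw [ht, hy, map_neg, inner_neg_neg, map_add, map_smul, map_smul, hv₁, hv₂, smul_smul, smul_smul,
    inner_combination hn₁ hn₂, sub_pos, div_lt_iff₀ hr2, ← hr]
  linarith

theorem norm_center_le_of_slow_indicator {M : Matrix (Fin 2) (Fin 2) ℝ} {l₁ l₂ c : ℝ}
    (hl : l₁ < l₂) (hc : l₂ < c) (hc0 : c < 0)
    (ht : M.trace = l₁ + l₂) (hd : M.det = l₁ * l₂) {v₁ v₂ : Vec 2} {β₁ β₂ : ℝ}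
    (hv₁ : M.toEuclideanLin v₁ = l₁ • v₁) (hv₂ : M.toEuclideanLin v₂ = l₂ • v₂) (hn₁ : ‖v₁‖ = 1)
    (hn₂ : ‖v₂‖ = 1) {xc : Vec 2} (hxc : xc = β₁ • v₁ + β₂ • v₂)
    (hβ : 0 ≤ β₁ * β₂ * inner ℝ v₂ v₁ + β₂ ^ 2) {x : Vec 2}
    (hx : M.toEuclideanLin x = c • (x - xc)) : ‖xc‖ ^ 2 ≤ ‖x - xc‖ ^ 2 := by
  rw [real_inner_comm] at hβ
  have hy := (equilibrium_iff ht hd hv₁ hv₂ hxc (by linarith) (by linarith)).1 hx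
  have hpos := sq_nonneg ‖xc‖
  rw [hxc, norm_combination_sq hn₁ hn₂] at hpos
  rw [hy, norm_neg, hxc, norm_combination_sq hn₁ hn₂, norm_combination_sq hn₁ hn₂]
  exact sq_le_sq_of_slow_indicator hl hc hc0 hβ hpos

theorem F₁_half_fst (r l₁ l₂ β₁ β₂ : ℝ) (v₁ v₂ : Vec 2) :
    F₁ r l₁ l₂ β₁ β₂ v₁ v₂ (l₁ / 2) = (l₁ * β₁ * (l₂ - l₁)) ^ 2 := by
  rw [F₁_eq]
  ring

theorem F₁_zero_pos {r l₁ l₂ β₁ β₂ : ℝ} {v₁ v₂ : Vec 2} (hn₁ : ‖v₁‖ = 1) (hn₂ : ‖v₂‖ = 1)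
    (h₁ : l₁ ≠ 0) (h₂ : l₂ ≠ 0) (h : r ^ 2 < ‖β₁ • v₁ + β₂ • v₂‖ ^ 2) :
    0 < F₁ r l₁ l₂ β₁ β₂ v₁ v₂ 0 := by
  rw [F₁_eq_mul r β₁ β₂ hn₁ hn₂ (by simpa using h₁) (by simpa using h₂)]
  simp only [mul_zero, sub_zero, mul_div_cancel_left₀ _ h₁, mul_div_cancel_left₀ _ h₂]
  exact mul_pos (by positivity) (sub_pos.2 h)

end SafetyFilter

theorem mainTheorem10
    (A B K : Matrix (Fin 2) (Fin 2) ℝ) (hB : IsUnit B)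
    (xc : Vec 2) (r : ℝ) (hr : 0 < r)
    (horigin : 0 < circularBarrier xc r 0)
    (α : ℝ → ℝ) (hα : IsExtendedClassKInf α)
    (hαdiff : DifferentiableAt ℝ α 0) (hαpos : 0 < deriv α 0)
    (hHurwitz : IsHurwitz (nominalMatrix A B K))
    (lam₁ lam₂ : ℝ) (hlam : lam₁ < lam₂)
    (hspec : complexEigenvalues (nominalMatrix A B K) = {(lam₁ : ℂ), (lam₂ : ℂ)})
    (hxc : ¬ IsEigenvector (nominalMatrix A B K) xc) :
    (∀ x ∈ undesiredEquilibria A B K (gramWeight B) (circularBarrier xc r), ∀ δ : ℝ,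
      HasIndicator A B K (gramWeight B) (circularBarrier xc r) x δ →
        δ ≠ lam₁ / 2 ∧ δ ≠ lam₂ / 2) ∧
    (∀ (v₁ v₂ : Vec 2) (β₁ β₂ : ℝ),
      (nominalMatrix A B K).toEuclideanLin v₁ = lam₁ • v₁ →
      (nominalMatrix A B K).toEuclideanLin v₂ = lam₂ • v₂ →
      0 ≤ inner ℝ v₁ v₂ → ‖v₁‖ = 1 → ‖v₂‖ = 1 → xc = β₁ • v₁ + β₂ • v₂ →
      (0 ≤ β₁ ^ 2 + β₁ * β₂ * inner ℝ v₁ v₂ →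
        ∀ x ∈ undesiredEquilibria A B K (gramWeight B) (circularBarrier xc r), ∀ δ : ℝ,
          HasIndicator A B K (gramWeight B) (circularBarrier xc r) x δ → δ < lam₁ / 2 →
            IsSaddlePoint
              (filteredField A B K (gramWeight B) (circularBarrier xc r) α) x) ∧
      (0 ≤ β₁ * β₂ * inner ℝ v₂ v₁ + β₂ ^ 2 →
        ∀ x ∈ undesiredEquilibria A B K (gramWeight B) (circularBarrier xc r), ∀ δ : ℝ,
          HasIndicator A B K (gramWeight B) (circularBarrier xc r) x δ →
          lam₂ / 2 < δ → δ < 0 →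
            IsAsymptoticallyStable
              (filteredField A B K (gramWeight B) (circularBarrier xc r) α) x) ∧
      ((∃! δ : ℝ, deriv (F₁ r lam₁ lam₂ β₁ β₂ v₁ v₂) δ = 0) →
        0 ≤ β₁ ^ 2 + β₁ * β₂ * inner ℝ v₁ v₂ →
        ∃ x, undesiredEquilibria A B K (gramWeight B) (circularBarrier xc r) = {x} ∧
          IsSaddlePoint
            (filteredField A B K (gramWeight B) (circularBarrier xc r) α) x)) := by
  obtain ⟨ht, hd⟩ := trace_and_det_of_complexEigenvalues hlam.ne hspec
  have hl₂ : lam₂ < 0 := by simpa using hHurwitz lam₂ (by simp [hspec])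
  have hl₁ : lam₁ < 0 := hlam.trans hl₂
  have hrc : r ^ 2 < ‖xc‖ ^ 2 := by
    rw [circularBarrier, zero_sub, norm_neg] at horigin
    linarith
  have hxc0 : xc ≠ 0 := by
    rintro rfl
    rw [norm_zero] at hrc
    nlinarith
  have hne : ∀ x δ, HasIndicator A B K (gramWeight B) (circularBarrier xc r) x δ →
      δ ≠ lam₁ / 2 ∧ δ ≠ lam₂ / 2 := by
    intro x δ hx
    have hx' := ((hasIndicator_iff hB).1 hx).2
    constructor <;> rintro rfl <;> rw [mul_div_cancel₀ _ two_ne_zero] at hx'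
    · exact hxc (isEigenvector_of_resonance ht hd hl₁.ne hxc0 hx')
    · exact hxc (isEigenvector_of_resonance (ht.trans (add_comm _ _)) (hd.trans (mul_comm _ _))
        hl₂.ne hxc0 hx')
  refine ⟨fun x _ => hne x, fun v₁ v₂ β₁ β₂ hv₁ hv₂ _ hn₁ hn₂ hβ => ⟨?_, ?_, ?_⟩⟩
  · intro hcond x _ δ hx hδ
    exact isSaddlePoint_of_lt hB hr hα.map_zero hαdiff hαpos hlam hl₂ ht hd hv₁ hv₂ hn₁ hn₂ hβ
      hcond hx hδ
  -- the hypotheses leave no equilibrium here: its distance to `xc` would be at least `‖xc‖ > r`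
  · intro hcond x _ δ hx hδ hδ0
    obtain ⟨hxr, hx⟩ := (hasIndicator_iff hB).1 hx
    have := norm_center_le_of_slow_indicator hlam (show lam₂ < 2 * δ by linarith) (by linarith)
      ht hd hv₁ hv₂ hn₁ hn₂ hβ hcond hx
    linarith
  · intro hcrit hcond
    obtain ⟨hβ₁, -⟩ := coefficients_ne_zero hv₁ hv₂ hβ hxc0 hxc
    have hs : 0 < F₁ r lam₁ lam₂ β₁ β₂ v₁ v₂ (lam₁ / 2) := by
      rw [F₁_half_fst]
      exact sq_pos_iff.2 (mul_ne_zero (mul_ne_zero hl₁.ne hβ₁) (sub_ne_zero.2 hlam.ne'))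
    have h0 := F₁_zero_pos hn₁ hn₂ hl₁.ne hl₂.ne (hβ ▸ hrc)
    obtain ⟨d, hds, hd0, huniq⟩ := exists_unique_zero_of_single_critical_point
      (differentiable_F₁ r lam₁ lam₂ β₁ β₂ v₁ v₂) hcrit
      (eventually_atBot_F₁_neg hr lam₁ lam₂ β₁ β₂ hn₁ hn₂)
      (eventually_atTop_F₁_neg hr lam₁ lam₂ β₁ β₂ hn₁ hn₂) (show lam₁ / 2 ≤ 0 by linarith) hs h0
    have hindicator : ∀ x δ, lam₁ - 2 * δ ≠ 0 → lam₂ - 2 * δ ≠ 0 →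
        (HasIndicator A B K (gramWeight B) (circularBarrier xc r) x δ ↔
          F₁ r lam₁ lam₂ β₁ β₂ v₁ v₂ δ = 0 ∧
          x - xc = -((lam₁ * β₁ / (lam₁ - 2 * δ)) • v₁ + (lam₂ * β₂ / (lam₂ - 2 * δ)) • v₂)) := by
      intro x δ h₁ h₂
      rw [hasIndicator_iff hB, equilibrium_iff ht hd hv₁ hv₂ hβ h₁ h₂]
      refine and_congr_left fun h => ?_
      rw [h, norm_neg, F₁_eq_mul r β₁ β₂ hn₁ hn₂ h₁ h₂, mul_eq_zero, sub_eq_zero,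
        or_iff_right (pow_ne_zero 2 (mul_ne_zero h₁ h₂))]
    have hd₁ : lam₁ - 2 * d ≠ 0 := by linarith
    have hd₂ : lam₂ - 2 * d ≠ 0 := by linarith
    set x : Vec 2 := xc - ((lam₁ * β₁ / (lam₁ - 2 * d)) • v₁ + (lam₂ * β₂ / (lam₂ - 2 * d)) • v₂)
      with hxdef
    have hx : HasIndicator A B K (gramWeight B) (circularBarrier xc r) x d :=
      (hindicator x d hd₁ hd₂).2 ⟨hd0, by rw [hxdef]; abel⟩
    refine ⟨x, Set.eq_singleton_iff_unique_mem.2 ⟨⟨d, by linarith, hx⟩, ?_⟩,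
      isSaddlePoint_of_lt hB hr hα.map_zero hαdiff hαpos hlam hl₂ ht hd hv₁ hv₂ hn₁ hn₂ hβ
        hcond hx hds⟩
    rintro z ⟨δ, hδ, hz⟩
    obtain ⟨hne₁, hne₂⟩ := hne z δ hz
    obtain ⟨hF, hzc⟩ := (hindicator z δ (fun h => hne₁ (by linarith))
      (fun h => hne₂ (by linarith))).1 hz
    obtain rfl := huniq δ hδ hF
    rw [hxdef, sub_eq_add_neg, ← hzc]
    abel
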